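/- **Theorem 3.1.** Matroids may be infinite: they are given by the independence axioms (I1)–(I3), (IM) of Bruhn, Diestel, Kriesell, Pendavingh and Wollan. A matroid $M$ with ground set $E$ is *tame* if $o\cap b$ is finite for every circuit $o$ and every cocircuit $b$ of $M$. It is a *binary thin sums matroid* if there are a set $A$ and a family $(f_e \mid e\in E)$ of functions $A\to\mathbb{F}_2$ such that a set $I\subseteq E$ is independent in $M$ if and only if the only family $(\lambda_e\mid e\in E)$ in $\mathbb{F}_2$ that is zero outside $I$ and satisfies $\sum_{e\in E}\lambda_e f_e(a)=0$ for all $a\in A$ (with only finitely many nonzero summands for each $a$) is the zero family. The symmetric difference $\triangle_{i\in I}o_i$ of a family of sets is well defined if every point lies in only finitely many $o_i$, and then consists of the points lying in an odd number of the $o_i$. Let $M$ be a tame matroid. Then the following are equivalent: 1. $M$ is a binary thin sums matroid. 2. For any circuit $o$ and cocircuit $b$ of $M$, $|o\cap b|$ is even. 3. For any circuit $o$ and cocircuit $b$ of $M$, $|o\cap b|\neq 3$. 4. $M$ has no minor isomorphic to $U_{2,4}$ (the matroid on four elements whose independent sets are the sets of at most two elements). 5. If $o_1,o_2$ are circuits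 of $M$, then $o_1\triangle o_2$ is empty or includes a circuit. 6. If $o_1,o_2$ are circuits of $M$, then $o_1\triangle o_2$ is a disjoint union of (possibly infinitely many, possibly no) circuits. 7. If $(o_i\mid i\in I)$ is a finite family of circuits of $M$, then $\triangle_{i\in I}o_i$ is empty or includes a circuit. 8. If $(o_i\mid i\in I)$ is a finite family of circuits of $M$, then $\triangle_{i\in I}o_i$ is a disjoint union of (possibly infinitely many, possibly no) circuits. 9. For any base $s$ of $M$ and any circuit $o$ of $M$, $\triangle_{e\in o\setminus s}o_e$ is well defined and equal to $o$, where $o_e$ is the fundamental circuit of $e$ with respect to $s$. -/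

import Mathlib

namespace Matroid

universe u v w

/-- A matroid is tame if every circuit-cocircuit intersection is finite. -/
def Tame {α : Type u} (M : Matroid α) : Prop :=
  ∀ o b : Set α, M.IsCircuit o → M.IsCocircuit b → (o ∩ b).Finite

/-- `c` is a thin dependence of the family `f` of functions from `A` to `k`: for each `a : A` the
sum of the `c e * f e a` is well defined (only finitely many nonzero summands) and equals zero. -/
def IsThinDependence {ι : Type u} {A : Type v} {k : Type w} [Field k]
    (f : ι → A → k) (c : ι → k) : Prop :=
  ∀ a : A, {e : ι | c e * f e a ≠ 0}.Finite ∧ ∑ᶠ e : ι, c e * f e a = 0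

/-- `I` is thinly independent for `f`: the only thin dependence of `f` that is zero everywhere
outside `I` is the zero family. -/
def ThinlyIndependent {ι : Type u} {A : Type v} {k : Type w} [Field k]
    (f : ι → A → k) (I : Set ι) : Prop :=
  ∀ c : ι → k, IsThinDependence f c → (∀ e, e ∉ I → c e = 0) → c = 0

/-- `M` is a thin sums matroid over `k`: its independent sets are exactly the thinly independent
sets of some family, indexed by the ground set, of functions from a set `A` to `k`.
(The universe of `A` is no restriction: members `a` of `A` that give the same function
`e ↦ f e a` on the ground set can be identified.) -/
def IsThinSums {α : Type u} (M : Matroid α) (k : Type w) [Field k] : Prop :=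
  ∃ (A : Type (max u w)) (f : M.E → A → k),
    ∀ I : Set M.E, M.Indep (Subtype.val '' I) ↔ ThinlyIndependent f I

/-- The uniform matroid `U_{r,n}`: the ground set has `n` elements, and the independent sets are
the sets of at most `r` elements. -/
def uniformMatroid (r n : ℕ) : Matroid (Fin n) :=
  (IndepMatroid.ofFinite (E := (Set.univ : Set (Fin n))) Set.finite_univ
    (fun I => I.ncard ≤ r)
    (by rw [Set.ncard_empty]; exact Nat.zero_le r)
    (fun I J hJ hIJ => (Set.ncard_le_ncard hIJ J.toFinite).trans hJ)
    (fun I J _ hJ hlt => by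
      obtain ⟨e, heJ, heI⟩ := Set.exists_mem_notMem_of_ncard_lt_ncard hlt I.toFinite
      exact ⟨e, heJ, heI, (Set.ncard_insert_le e I).trans (hlt.trans_le hJ)⟩)
    (fun I _ => Set.subset_univ I)).matroid

/-- Two matroids are isomorphic if there is a bijection between their ground sets that preserves
independence in both directions. -/
def Isomorphic {α : Type u} {β : Type v} (M : Matroid α) (N : Matroid β) : Prop :=
  ∃ φ : M.E ≃ N.E, ∀ I : Set M.E,
    M.Indep (Subtype.val '' I) ↔ N.Indep (Subtype.val '' (φ '' I))

/-- `X` includes a circuit of `M`. -/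
def IncludesCircuit {α : Type u} (M : Matroid α) (X : Set α) : Prop :=
  ∃ o, M.IsCircuit o ∧ o ⊆ X

/-- `X` is a disjoint union of (possibly infinitely many, possibly no) circuits of `M`. -/
def IsDisjointUnionOfCircuits {α : Type u} (M : Matroid α) (X : Set α) : Prop :=
  ∃ S : Set (Set α), (∀ o ∈ S, M.IsCircuit o) ∧ S.PairwiseDisjoint id ∧ X = ⋃₀ S

/-- `X` is the symmetric difference of the family `o` of sets: it is well defined, in that every
point is in only finitely many members of the family, and `X` consists of the points that are in
an odd number of members of the family. -/
def IsSymmDiffOf {α : Type u} {ι : Type v} (X : Set α) (o : ι → Set α) : Prop :=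
  ∀ x : α, {i : ι | x ∈ o i}.Finite ∧ (x ∈ X ↔ Odd {i : ι | x ∈ o i}.ncard)

end Matroid

/-! Statement (2), parity of circuit-cocircuit intersections, is the hub. It is useful because a
nonempty independent set meets some cocircuit in exactly one element, so a nonempty set that meets
every cocircuit in a finite even set must include a circuit. Removing a maximal disjoint family of
circuits then gives (8), hence (6) and (7), and the incidence vectors of elements against cocircuits
form a thin sums representation, giving (1). For (9), parity is tested on fundamental cocircuits;
every cocircuit is one for a suitable base.

Conversely, a failure of (2) produces a copy of `U_{2,4}` (`even_ncard_inter_of_forall_not_isQuad`):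
tameness permits choosing an odd intersection of least size, and two basis exchanges expose four
elements that violate binary behaviour. Such a copy contradicts (3), (4) and (5): it yields a
circuit and a cocircuit sharing three elements, a `U_{2,4}` minor, and two circuits with nonempty
independent symmetric difference. -/

namespace Matroid

open Set

universe u

variable {α : Type u} {M : Matroid α}

/-! ### Copies of `U_{2,4}` over an independent set -/

/-- `C` and `q` exhibit a restriction of the contraction of the independent set `C` that is a copy
of `U_{2,4}` on the four elements `q i`. -/
structure IsQuad (M : Matroid α) (C : Set α) (q : Fin 4 → α) : Prop where
  injective : Function.Injective q
  notMem : ∀ i, q i ∉ C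
  indep : ∀ i j, i ≠ j → M.Indep (insert (q i) (insert (q j) C))
  not_indep : ∀ i j k, i ≠ j → i ≠ k → j ≠ k →
    ¬ M.Indep (insert (q i) (insert (q j) (insert (q k) C)))

lemma IsQuad.indep_self {C : Set α} {q : Fin 4 → α} (h : M.IsQuad C q) : M.Indep C :=
  (h.indep 0 1 (by decide)).subset ((subset_insert _ _).trans (subset_insert _ _))

lemma IsQuad.mem_ground {C : Set α} {q : Fin 4 → α} (h : M.IsQuad C q) (i : Fin 4) :
    q i ∈ M.E := by
  obtain ⟨j, hj⟩ := exists_ne i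
  exact (h.indep i j hj.symm).subset_ground (mem_insert _ _)

lemma IsQuad.exists_isCircuit {C : Set α} {q : Fin 4 → α} (h : M.IsQuad C q) {i j k : Fin 4}
    (hij : i ≠ j) (hik : i ≠ k) (hjk : j ≠ k) :
    ∃ o, M.IsCircuit o ∧ o ⊆ insert (q i) (insert (q j) (insert (q k) C)) ∧
      q i ∈ o ∧ q j ∈ o ∧ q k ∈ o := by
  have hdep : M.Dep (insert (q i) (insert (q j) (insert (q k) C))) := by
    refine ⟨h.not_indep i j k hij hik hjk, insert_subset (h.mem_ground i) ?_⟩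
    exact (h.indep j k hjk).subset_ground
  obtain ⟨o, hos, ho⟩ := hdep.exists_isCircuit_subset
  refine ⟨o, ho, hos, ?_, ?_, ?_⟩ <;> by_contra hmem
  · refine ho.not_indep ((h.indep j k hjk).subset fun x hx ↦ ?_)
    have := hos hx
    grind
  · refine ho.not_indep ((h.indep i k hik).subset fun x hx ↦ ?_)
    have := hos hx
    grind
  · refine ho.not_indep ((h.indep i j hij).subset fun x hx ↦ ?_)
    have := hos hx
    grind

/-- An independent triple over `C` would properly contain one of the bases. -/
lemma isQuad_of_isBase {C : Set α} {q : Fin 4 → α} (hq : Function.Injective q)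
    (hC : ∀ i, q i ∉ C) (hB : ∀ i j, i < j → M.IsBase (insert (q i) (insert (q j) C))) :
    M.IsQuad C q := by
  have hB' : ∀ i j, i ≠ j → M.IsBase (insert (q i) (insert (q j) C)) := by
    intro i j hij
    obtain h | h := lt_or_gt_of_ne hij
    · exact hB i j h
    · rw [insert_comm]
      exact hB j i h
  refine ⟨hq, hC, fun i j hij ↦ (hB' i j hij).indep, fun i j k hij hik hjk hI ↦ ?_⟩
  have heq := (hB' j k hjk).eq_of_subset_indep hI (subset_insert _ _)
  have hi : q i ∈ insert (q j) (insert (q k) C) := heq ▸ mem_insert _ _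
  simp [hq.eq_iff, hij, hik, hC] at hi

/-- Take a circuit through `q 0`, `q 1`, `q 2` and a base `B` containing `C`, `q 0` and `q 3`. The
fundamental cocircuit of `q 0` avoids `C` and `q 3`, and it contains `q 1` and `q 2` because their
fundamental circuits pass through `q 0`. -/
lemma IsQuad.exists_isCircuit_isCocircuit {C : Set α} {q : Fin 4 → α} (h : M.IsQuad C q) :
    ∃ o b, M.IsCircuit o ∧ M.IsCocircuit b ∧ (o ∩ b).encard = 3 := by
  obtain ⟨B, hB, hCB⟩ := (h.indep 0 3 (by decide)).exists_isBase_superset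
  obtain ⟨o, ho, hos, h0, h1, h2⟩ := h.exists_isCircuit (i := 0) (j := 1) (k := 2)
    (by decide) (by decide) (by decide)
  have h0B : q 0 ∈ B := hCB (by simp)
  have h3B : q 3 ∈ B := hCB (by simp)
  have hK : ∀ i, i ≠ 0 → i ≠ 3 → q i ∈ M.fundCocircuit (q 0) B := by
    intro i hi0 hi3
    obtain ⟨c, hc, hcs, -, hc0, -⟩ := h.exists_isCircuit (i := i) (j := 0) (k := 3)
      hi0 hi3 (by decide)
    rw [hB.mem_fundCocircuit_iff_mem_fundCircuit,
      ← hc.eq_fundCircuit_of_subset hB.indep (hcs.trans (insert_subset_insert hCB))]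
    exact hc0
  refine ⟨o, M.fundCocircuit (q 0) B, ho, fundCocircuit_isCocircuit h0B hB, ?_⟩
  have heq : o ∩ M.fundCocircuit (q 0) B = {q 0, q 1, q 2} := by
    refine subset_antisymm ?_ ?_
    · rintro x ⟨hxo, hxK⟩
      have h' := M.fundCocircuit_subset_insert_compl (q 0) B hxK
      have := hos hxo
      have hC : x ∈ C → x ∈ B := fun hx ↦ hCB (by simp [hx])
      grind
    · rintro x (rfl | rfl | rfl)
      · exact ⟨h0, mem_fundCocircuit _ _ _⟩
      · exact ⟨h1, hK 1 (by decide) (by decide)⟩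
      · exact ⟨h2, hK 2 (by decide) (by decide)⟩
  rw [heq]
  refine encard_eq_three.2 ⟨_, _, _, ?_, ?_, ?_, rfl⟩ <;>
  · rw [h.injective.ne_iff]
    decide

/-- Circuits through `q 0, q 1, q 2` and through `q 0, q 1, q 3` cancel at `q 0` and `q 1`, leaving
part of the independent set `C ∪ {q 2, q 3}`. -/
lemma IsQuad.exists_isCircuit_symmDiff {C : Set α} {q : Fin 4 → α} (h : M.IsQuad C q) :
    ∃ o₁ o₂, M.IsCircuit o₁ ∧ M.IsCircuit o₂ ∧ (symmDiff o₁ o₂).Nonempty ∧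
      M.Indep (symmDiff o₁ o₂) := by
  obtain ⟨o₁, ho₁, hs₁, h0, h1, h2⟩ := h.exists_isCircuit (i := 0) (j := 1) (k := 2)
    (by decide) (by decide) (by decide)
  obtain ⟨o₂, ho₂, hs₂, h0', h1', h3⟩ := h.exists_isCircuit (i := 0) (j := 1) (k := 3)
    (by decide) (by decide) (by decide)
  refine ⟨o₁, o₂, ho₁, ho₂, ⟨q 2, Or.inl ⟨h2, fun h2o ↦ ?_⟩⟩,
    (h.indep 2 3 (by decide)).subset ?_⟩
  · have := hs₂ h2o
    simp [h.injective.eq_iff, h.notMem] at this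
  · rintro x (⟨hx, hx'⟩ | ⟨hx, hx'⟩)
    · have := hs₁ hx
      grind
    · have := hs₂ hx
      grind

/-! ### Translation to and from `U_{2,4}` minors -/

lemma uniformMatroid_indep_iff {r n : ℕ} {I : Set (Fin n)} :
    (uniformMatroid r n).Indep I ↔ I.ncard ≤ r := by
  simp [uniformMatroid]

lemma IsQuad.exists_isMinor {C : Set α} {q : Fin 4 → α} (h : M.IsQuad C q) :
    ∃ N : Matroid α, N ≤m M ∧ N.Isomorphic (uniformMatroid 2 4) := by
  have hss : range q ⊆ (M ／ C).E := by
    rintro _ ⟨i, rfl⟩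
    exact ⟨h.mem_ground i, h.notMem i⟩
  refine ⟨(M ／ C) ↾ range q, ?_, ?_⟩
  · rw [← delete_compl hss]
    exact contract_delete_isMinor _ _ _
  let φ : Fin 4 ≃ ((M ／ C) ↾ range q).E := Equiv.ofInjective q h.injective
  let ψ : Fin 4 ≃ (uniformMatroid 2 4).E := (Equiv.Set.univ (Fin 4)).symm
  refine ⟨φ.symm.trans ψ, fun I ↦ ?_⟩
  obtain ⟨J, rfl⟩ : ∃ J : Set (Fin 4), φ '' J = I := ⟨φ ⁻¹' I, image_preimage_eq _ φ.surjective⟩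
  have h1 : Subtype.val '' (φ '' J) = q '' J := by
    rw [image_image]; rfl
  have h2 : Subtype.val '' ((φ.symm.trans ψ) '' (φ '' J)) = J := by
    have : (fun i ↦ ((φ.symm.trans ψ (φ i) : (uniformMatroid 2 4).E) : Fin 4)) = id :=
      funext fun i ↦ congrArg (fun i ↦ (ψ i : Fin 4)) (φ.symm_apply_apply i)
    rw [image_image, image_image, this, image_id]
  have hdj : Disjoint (q '' J) C := by
    rw [disjoint_left]
    rintro _ ⟨i, -, rfl⟩
    exact h.notMem i
  rw [h1, h2, uniformMatroid_indep_iff, restrict_indep_iff, h.indep_self.contract_indep_iff,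
    and_iff_left (image_subset_range _ _), and_iff_right hdj]
  refine ⟨fun hI ↦ ?_, fun hJ ↦ ?_⟩
  · by_contra! hlt
    obtain ⟨i, j, k, hi, hj, hk, hij, hik, hjk⟩ := (two_lt_ncard_iff J.toFinite).1 hlt
    refine h.not_indep i j k hij hik hjk (hI.subset ?_)
    have := mem_image_of_mem q hi
    have := mem_image_of_mem q hj
    have := mem_image_of_mem q hk
    grind
  · obtain ⟨i, j, hij, hJij⟩ : ∃ i j, i ≠ j ∧ J ⊆ {i, j} := by
      obtain ⟨K, hJK, -, hK⟩ := exists_subsuperset_card_eq (subset_univ J) hJ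
        (by rw [ncard_univ]; simp)
      obtain ⟨i, j, hij, rfl⟩ := ncard_eq_two.1 hK
      exact ⟨i, j, hij, hJK⟩
    refine (h.indep i j hij).subset ?_
    rintro x (⟨l, hl, rfl⟩ | hx)
    · obtain rfl | rfl := hJij hl <;> simp
    · simp [hx]

lemma exists_isQuad_of_isMinor {N : Matroid α} (hN : N ≤m M)
    (hiso : N.Isomorphic (uniformMatroid 2 4)) : ∃ C q, M.IsQuad C q := by
  obtain ⟨C, D, rfl⟩ := hN
  obtain ⟨φ, hφ⟩ := hiso
  -- The contracted set need not be independent; a basis of it takes its place.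
  obtain ⟨I, hI⟩ := M.exists_isBasis' C
  let ψ : Fin 4 ≃ (M ／ C ＼ D).E := (Equiv.Set.univ (Fin 4)).symm.trans φ.symm
  have hψ : ∀ J : Set (Fin 4), (M ／ C ＼ D).Indep (Subtype.val '' (ψ '' J)) ↔ J.ncard ≤ 2 := by
    intro J
    have : (fun i ↦ ((φ (ψ i) : (uniformMatroid 2 4).E) : Fin 4)) = id :=
      funext fun i ↦ congrArg Subtype.val (φ.apply_symm_apply _)
    rw [hφ, uniformMatroid_indep_iff, image_image, image_image, this, image_id]
  have hmem : ∀ i, (ψ i : α) ∉ C ∧ (ψ i : α) ∉ D := fun i ↦ ⟨(ψ i).2.1.2, (ψ i).2.2⟩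
  have hind : ∀ J : Set (Fin 4), M.Indep (((fun i ↦ (ψ i : α)) '' J) ∪ I) ↔ J.ncard ≤ 2 := by
    intro J
    rw [← hψ, delete_indep_iff, hI.contract_indep_iff, image_image]
    simp only [disjoint_left, mem_image]
    grind
  refine ⟨I, fun i ↦ ψ i, Subtype.val_injective.comp ψ.injective,
    fun i hi ↦ (hmem i).1 (hI.subset hi), fun i j hij ↦ ?_, fun i j k hij hik hjk hd ↦ ?_⟩
  · have := (hind {i, j}).2 (ncard_pair hij).le
    simpa [image_insert_eq, insert_union] using this
  · have := (hind {i, j, k}).1 (by simpa [image_insert_eq, insert_union] using hd)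
    rw [ncard_eq_three.2 ⟨i, j, k, hij, hik, hjk, rfl⟩] at this
    omega

/-! ### Cocircuits, basis exchange and the parity descent -/

/-- The complement of `b` is a maximal nonspanning set. A basis of it containing `I` becomes a base
once `x` is added, and this base meets `b` only in `x`. -/
lemma IsCocircuit.exists_isBase_fundCocircuit_eq {b I : Set α} {x : α} (hb : M.IsCocircuit b)
    (hI : M.Indep I) (hIb : Disjoint I b) (hx : x ∈ b) :
    ∃ s, M.IsBase s ∧ x ∈ s ∧ I ⊆ s ∧ s ∩ b = {x} ∧ M.fundCocircuit x s = b := by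
  have hmin := isCocircuit_iff_minimal_compl_nonspanning.1 hb
  obtain ⟨J, hJ, hIJ⟩ := hI.subset_isBasis_of_subset (subset_sdiff.2 ⟨hI.subset_ground, hIb⟩)
  have hxE := hb.subset_ground hx
  have hxb : x ∉ M.E \ b := fun h ↦ h.2 hx
  have hsp : M.Spanning (insert x (M.E \ b)) := by
    have h := hmin.not_prop_of_ssubset (sdiff_singleton_ssubset.2 hx)
    rw [not_not] at h
    convert h using 1
    ext y
    by_cases hyx : y = x <;> simp [hyx, hxE]
  have hJsp : M.Spanning (insert x J) := by
    rw [spanning_iff_closure_eq (insert_subset hxE hJ.indep.subset_ground),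
      closure_insert_congr_right hJ.closure_eq_closure]
    exact hsp.closure_eq
  have hxcl : x ∉ M.closure J := by
    intro hxJ
    refine hmin.prop ?_
    rw [spanning_iff_closure_eq, ← hJ.closure_eq_closure, ← closure_insert_eq_of_mem_closure hxJ]
    exact hJsp.closure_eq
  have hs : M.IsBase (insert x J) :=
    (hJ.indep.insert_indep_iff_of_notMem (fun h ↦ hxb (hJ.subset h))).2 ⟨hxE, hxcl⟩
      |>.isBase_of_spanning hJsp
  have hinter : insert x J ∩ b = {x} := by
    have := hJ.subset
    ext y
    simp only [mem_inter_iff, mem_insert_iff, mem_singleton_iff]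
    grind
  refine ⟨insert x J, hs, mem_insert _ _, hIJ.trans (subset_insert _ _), hinter, ?_⟩
  refine (IsCircuit.eq_fundCircuit_of_subset hb.isCircuit hs.compl_isBase_dual.indep ?_).symm
  intro y hy
  by_cases hyx : y = x
  · exact Or.inl hyx
  · refine Or.inr ⟨hb.subset_ground hy, fun hys ↦ hyx ?_⟩
    exact (hinter.subset ⟨hys, hy⟩)

lemma IsBase.insert_sdiff_of_mem_fundCircuit {s : Set α} {x y : α} (hs : M.IsBase s)
    (hy : y ∈ M.E) (hys : y ∉ s) (hx : x ∈ M.fundCircuit y s) (hxs : x ∈ s) :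
    M.IsBase (insert y (s \ {x})) := by
  rw [hs.indep.mem_fundCircuit_iff (by rwa [hs.closure_eq]) hys] at hx
  refine hs.exchange_isBase_of_indep hys ?_
  rwa [insert_sdiff_singleton_comm (by rintro rfl; exact hys hxs)]

lemma isQuad_of_isBase_of_ne {C : Set α} {a b c d : α} (hab : a ≠ b) (hac : a ≠ c) (had : a ≠ d)
    (hbc : b ≠ c) (hbd : b ≠ d) (hcd : c ≠ d) (ha : a ∉ C) (hb : b ∉ C) (hc : c ∉ C) (hd : d ∉ C)
    (hBab : M.IsBase (insert a (insert b C))) (hBac : M.IsBase (insert a (insert c C)))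
    (hBad : M.IsBase (insert a (insert d C))) (hBbc : M.IsBase (insert b (insert c C)))
    (hBbd : M.IsBase (insert b (insert d C))) (hBcd : M.IsBase (insert c (insert d C))) :
    M.IsQuad C ![a, b, c, d] := by
  refine isQuad_of_isBase ?_ ?_ ?_
  · intro i j hij
    fin_cases i <;> fin_cases j <;> simp_all
  · intro i
    fin_cases i <;> assumption
  · intro i j hij
    fin_cases i <;> fin_cases j <;> first | exact absurd hij (by decide) | assumption

/-- If some cocircuit meets the circuit `o` in an odd number of elements, then one chosen with as
few elements of `o` as possible can be pivoted into a copy of `U_{2,4}`. -/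
lemma even_ncard_inter_of_forall_not_isQuad (hM : M.Tame) (hquad : ∀ C q, ¬ M.IsQuad C q)
    {o : Set α} (ho : M.IsCircuit o) (b : Set α) (hb : M.IsCocircuit b) :
    Even (o ∩ b).ncard := by
  induction hn : (o ∩ b).ncard using Nat.strong_induction_on generalizing b with
  | _ n ih
  subst hn
  by_contra hodd
  have hfin := hM o b ho hb
  have hne : (o ∩ b).Nonempty := by
    rw [nonempty_iff_ne_empty]
    intro h
    simp [h] at hodd
  obtain ⟨x, hx, y₁, hy₁, hxy₁⟩ := ho.isCocircuit_inter_nontrivial hb hne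
  have ih' : ∀ K, M.IsCocircuit K → ∀ z ∈ o ∩ b, z ∉ K → o ∩ K ⊆ o ∩ b →
      Even (o ∩ K).ncard := fun K hK z hz hzK hss ↦
    ih _ (ncard_lt_ncard ⟨hss, fun h ↦ hzK (h hz).2⟩ hfin) K hK rfl
  have hI : M.Indep (o \ b) := ho.ssubset_indep ⟨sdiff_subset, fun h ↦ (h hx.1).2 hx.2⟩
  obtain ⟨s, hs, hxs, hos, hsb, rfl⟩ :=
    hb.exists_isBase_fundCocircuit_eq hI disjoint_sdiff_left hx.2
  set b := M.fundCocircuit x s with hbdef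
  have hns : ∀ y ∈ o ∩ b, y ≠ x → y ∉ s := fun y hy hyx hys ↦ hyx (hsb.subset ⟨hys, hy.2⟩)
  have hE : ∀ y ∈ o ∩ b, y ∈ M.E := fun y hy ↦ ho.subset_ground hy.1
  have hxo : ∀ y ∈ o ∩ b, x ∈ M.fundCircuit y s := fun y hy ↦
    hs.mem_fundCocircuit_iff_mem_fundCircuit.1 hy.2
  have hy₁s := hns y₁ hy₁ hxy₁.symm
  have hc₁ := hs.fundCircuit_isCircuit (hE _ hy₁) hy₁s
  -- A fundamental circuit inside `o` would equal `o`, which would then meet `b` in just `x` and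
  -- `y₁`, an even number.
  obtain ⟨w, hwy₁, hwo⟩ : ∃ w ∈ M.fundCircuit y₁ s, w ∉ o := by
    by_contra! hcon
    have heq := hc₁.eq_of_subset_isCircuit ho hcon
    refine hodd ?_
    have : o ∩ b = {x, y₁} := by
      refine subset_antisymm ?_ (by rintro _ (rfl | rfl) <;> assumption)
      rintro z hz
      obtain rfl | hzs := M.fundCircuit_subset_insert y₁ s (heq ▸ hz.1)
      · simp
      · exact Or.inl (hsb.subset ⟨hzs, hz.2⟩)
    rw [this, ncard_pair hxy₁]
    decide
  have hws : w ∈ s := by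
    obtain rfl | h := M.fundCircuit_subset_insert y₁ s hwy₁
    · exact (hwo hy₁.1).elim
    · exact h
  have hwx : w ≠ x := by
    rintro rfl
    exact hwo hx.1
  -- the elements of `o ∩ b` whose fundamental circuit contains `w`
  set P := o ∩ M.fundCocircuit w s with hP
  have hPb : P ⊆ o ∩ b := by
    rintro z ⟨hzo, hzK⟩
    refine ⟨hzo, by_contra fun hzb ↦ ?_⟩
    obtain rfl | hz := M.fundCocircuit_subset_insert_compl w s hzK
    · exact hwo hzo
    · exact hz.2 (hos ⟨hzo, hzb⟩)
  have hxP : x ∉ P := by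
    rintro ⟨-, hxK⟩
    obtain h | h := M.fundCocircuit_subset_insert_compl w s hxK
    · exact hwx h.symm
    · exact h.2 hxs
  have hPeven : Even P.ncard := ih' _ (fundCocircuit_isCocircuit hws hs) x hx
    (fun h ↦ hxP ⟨hx.1, h⟩) hPb
  have hs₂ : M.IsBase (insert y₁ (s \ {w})) :=
    hs.insert_sdiff_of_mem_fundCircuit (hE _ hy₁) hy₁s hwy₁ hws
  set s₂ := insert y₁ (s \ {w}) with hs₂def
  have hxs₂ : x ∈ s₂ := Or.inr ⟨hxs, hwx.symm⟩
  set K := M.fundCocircuit x s₂ with hK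
  have hy₁K : y₁ ∉ K := by
    intro h
    obtain h | h := M.fundCocircuit_subset_insert_compl x s₂ h
    · exact hxy₁ h.symm
    · exact h.2 (mem_insert _ _)
  have hKb : o ∩ K ⊆ o ∩ b := by
    rintro z ⟨hzo, hzK⟩
    refine ⟨hzo, by_contra fun hzb ↦ ?_⟩
    obtain rfl | hz := M.fundCocircuit_subset_insert_compl x s₂ hzK
    · exact hzb hx.2
    · refine hz.2 (Or.inr ⟨hos ⟨hzo, hzb⟩, ?_⟩)
      rintro rfl
      exact hwo hzo
  have hKeven : Even (o ∩ K).ncard :=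
    ih' K (fundCocircuit_isCocircuit hxs₂ hs₂) y₁ hy₁ hy₁K hKb
  -- If `K` missed `P`, then `o ∩ b` would be the disjoint union of the even sets `o ∩ K` and `P`:
  -- the exchange of `w` for `y₁` leaves unchanged every fundamental circuit avoiding `w`.
  obtain ⟨y₂, hy₂P, hy₂K⟩ : ∃ y₂ ∈ P, y₂ ∈ K := by
    by_contra! hcon
    have hKeq : o ∩ K = (o ∩ b) \ P := by
      refine subset_antisymm (fun z hz ↦ ⟨hKb hz, fun hzP ↦ hcon z hzP hz.2⟩) ?_
      rintro z ⟨hz, hzP⟩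
      refine ⟨hz.1, ?_⟩
      obtain rfl | hzx := eq_or_ne z x
      · exact mem_fundCocircuit _ _ _
      have hwz : w ∉ M.fundCircuit z s := fun h ↦
        hzP ⟨hz.1, hs.mem_fundCocircuit_iff_mem_fundCircuit.2 h⟩
      have hss : M.fundCircuit z s ⊆ insert z s₂ := by
        intro t ht
        obtain rfl | hts := M.fundCircuit_subset_insert z s ht
        · exact mem_insert _ _
        · refine Or.inr (Or.inr ⟨hts, ?_⟩)
          rintro rfl
          exact hwz ht
      have heq := (hs.fundCircuit_isCircuit (hE z hz) (hns z hz hzx)).eq_fundCircuit_of_subset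
        hs₂.indep hss
      rw [hK, hs₂.mem_fundCocircuit_iff_mem_fundCircuit, ← heq]
      exact hxo z hz
    have hadd := ncard_sdiff_add_ncard_of_subset hPb hfin
    rw [← hKeq] at hadd
    exact hodd (hadd ▸ hKeven.add hPeven)
  have hy₂ := hPb hy₂P
  have hxy₂ : y₂ ≠ x := fun h ↦ hxP (h ▸ hy₂P)
  have hy₁₂ : y₁ ≠ y₂ := fun h ↦ hy₁K (h ▸ hy₂K)
  have hy₂s := hns y₂ hy₂ hxy₂
  have hwy₂ : w ∈ M.fundCircuit y₂ s := hs.mem_fundCocircuit_iff_mem_fundCircuit.1 hy₂P.2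
  have hy₂s₂ : y₂ ∉ s₂ := by
    rintro (h | h)
    · exact hy₁₂ h.symm
    · exact hy₂s h.1
  -- With `s` and `s₂`, these four exchanges make every pair from `x, w, y₁, y₂` complete `s \ {x,
  -- w}` to a base.
  have hB₁ := hs.insert_sdiff_of_mem_fundCircuit (hE _ hy₁) hy₁s (hxo _ hy₁) hxs
  have hB₂ := hs.insert_sdiff_of_mem_fundCircuit (hE _ hy₂) hy₂s (hxo _ hy₂) hxs
  have hB₃ := hs.insert_sdiff_of_mem_fundCircuit (hE _ hy₂) hy₂s hwy₂ hws
  have hB₄ := hs₂.insert_sdiff_of_mem_fundCircuit (hE _ hy₂) hy₂s₂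
    (hs₂.mem_fundCocircuit_iff_mem_fundCircuit.1 hy₂K) hxs₂
  have hne₁ : w ≠ y₁ := fun h ↦ hy₁s (h ▸ hws)
  have hne₂ : w ≠ y₂ := fun h ↦ hy₂s (h ▸ hws)
  have e₁ : insert x (insert w (s \ {x, w})) = s := by
    ext z; simp only [mem_insert_iff, mem_sdiff, mem_singleton_iff]; grind
  have e₂ : insert w (s \ {x, w}) = s \ {x} := by
    ext z; simp only [mem_insert_iff, mem_sdiff, mem_singleton_iff]; grind
  have e₃ : insert x (s \ {x, w}) = s \ {w} := by
    ext z; simp only [mem_insert_iff, mem_sdiff, mem_singleton_iff]; grind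
  have e₄ : insert y₁ (s \ {x, w}) = s₂ \ {x} := by
    ext z; simp only [hs₂def, mem_insert_iff, mem_sdiff, mem_singleton_iff]; grind
  refine hquad (s \ {x, w}) ![x, w, y₁, y₂] (isQuad_of_isBase_of_ne hwx.symm hxy₁ hxy₂.symm hne₁
    hne₂ hy₁₂ (by simp) (by simp) (fun h ↦ hy₁s h.1) (fun h ↦ hy₂s h.1) ?_ ?_ ?_ ?_ ?_ ?_)
  · rwa [e₁]
  · rwa [insert_comm, e₃]
  · rwa [insert_comm, e₃]
  · rwa [insert_comm, e₂]
  · rwa [insert_comm, e₂]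
  · rwa [insert_comm, e₄]

/-! ### Decomposition into disjoint circuits by parity -/

lemma exists_isCocircuit_inter_eq_singleton {X : Set α} (hXE : X ⊆ M.E) (hne : X.Nonempty)
    (hX : ¬ M.IncludesCircuit X) : ∃ K x, M.IsCocircuit K ∧ x ∈ X ∧ K ∩ X = {x} := by
  have hI : M.Indep X := by
    by_contra h
    obtain ⟨o, hoX, ho⟩ := Dep.exists_isCircuit_subset ⟨h, hXE⟩
    exact hX ⟨o, ho, hoX⟩
  obtain ⟨x, hx⟩ := hne
  obtain ⟨K, hK, hKX⟩ := hI.exists_isCocircuit_inter_eq_mem hx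
  exact ⟨K, x, hK, hx, hKX⟩

/-- A set meeting every member of a disjoint family evenly meets its union evenly. -/
lemma even_ncard_inter_sUnion {S : Set (Set α)} {K : Set α} (hS : S.PairwiseDisjoint id)
    (hfin : (⋃₀ S ∩ K).Finite) (heven : ∀ o ∈ S, Even (o ∩ K).ncard) :
    Even (⋃₀ S ∩ K).ncard := by
  -- `S` may be infinite, so the induction counts points of the intersection; each step removes a
  -- member meeting `K`.
  induction hn : (⋃₀ S ∩ K).ncard using Nat.strong_induction_on generalizing S with
  | _ n ih
  subst hn
  obtain h | ⟨x, ⟨o, ho, hxo⟩, hxK⟩ := (⋃₀ S ∩ K).eq_empty_or_nonempty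
  · simp [h]
  have hsplit : ⋃₀ S ∩ K = (o ∩ K) ∪ (⋃₀ (S \ {o}) ∩ K) := by
    rw [← union_inter_distrib_right]
    congr 1
    ext y
    simp only [mem_sUnion, mem_union, mem_sdiff, mem_singleton_iff]
    grind
  have hdj : Disjoint (o ∩ K) (⋃₀ (S \ {o}) ∩ K) := by
    refine Disjoint.mono inter_subset_left inter_subset_left ?_
    rw [disjoint_sUnion_right]
    exact fun t ht ↦ hS ho ht.1 fun h ↦ ht.2 h.symm
  have hss : ⋃₀ (S \ {o}) ∩ K ⊆ ⋃₀ S ∩ K := hsplit ▸ subset_union_right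
  have hfin' := hfin.subset hss
  have hlt : (⋃₀ (S \ {o}) ∩ K).ncard < (⋃₀ S ∩ K).ncard :=
    ncard_lt_ncard ⟨hss, fun h ↦ disjoint_left.1 hdj ⟨hxo, hxK⟩ (h ⟨⟨o, ho, hxo⟩, hxK⟩)⟩ hfin
  rw [hsplit, ncard_union_eq hdj (hfin.subset (hsplit ▸ subset_union_left)) hfin']
  exact (heven o ho).add (ih _ hlt (hS.subset sdiff_subset) hfin'
    (fun t ht ↦ heven t ht.1) rfl)

/-- If circuits meet cocircuits evenly, then a set that meets every cocircuit in a finite even set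
is a disjoint union of circuits. -/
lemma isDisjointUnionOfCircuits_of_even
    (heven : ∀ o K, M.IsCircuit o → M.IsCocircuit K → Even (o ∩ K).ncard) {X : Set α}
    (hXE : X ⊆ M.E) (hX : ∀ K, M.IsCocircuit K → (X ∩ K).Finite ∧ Even (X ∩ K).ncard) :
    M.IsDisjointUnionOfCircuits X := by
  obtain ⟨S, hSmax⟩ : ∃ S, Maximal
      (fun S : Set (Set α) ↦ (∀ o ∈ S, M.IsCircuit o ∧ o ⊆ X) ∧ S.PairwiseDisjoint id) S := by
    refine zorn_subset _ fun c hc hchain ↦ ⟨⋃₀ c, ⟨?_, ?_⟩, fun s hs ↦ subset_sUnion_of_mem hs⟩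
    · rintro o ⟨T, hT, hoT⟩
      exact (hc hT).1 o hoT
    · exact (pairwiseDisjoint_sUnion hchain.directedOn).2 fun T hT ↦ (hc hT).2
  obtain ⟨hS, hSdj⟩ := hSmax.prop
  have hSX : ⋃₀ S ⊆ X := sUnion_subset fun o ho ↦ (hS o ho).2
  refine ⟨S, fun o ho ↦ (hS o ho).1, hSdj, hSX.antisymm' ?_⟩
  by_contra hns
  have hne : (X \ ⋃₀ S).Nonempty := by rwa [sdiff_nonempty]
  -- A circuit in the remainder contradicts maximality; otherwise some cocircuit meets the remainder
  -- once, so its intersections with `X` and `⋃₀ S` differ in parity.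
  by_cases hinc : M.IncludesCircuit (X \ ⋃₀ S)
  · obtain ⟨o, ho, hoX⟩ := hinc
    have hdj : ∀ t ∈ S, Disjoint o t := fun t ht ↦
      (disjoint_sdiff_left.mono_left hoX).mono_right (subset_sUnion_of_mem ht)
    have hmem : o ∈ S := by
      refine hSmax.mem_of_prop_insert ⟨?_, ?_⟩
      · rintro t (rfl | ht)
        · exact ⟨ho, hoX.trans sdiff_subset⟩
        · exact hS t ht
      · exact hSdj.insert fun t ht _ ↦ hdj t ht
    exact ho.nonempty.ne_empty (disjoint_self.1 (hdj o hmem))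
  · obtain ⟨K, x, hK, hx, hKx⟩ :=
      exists_isCocircuit_inter_eq_singleton (sdiff_subset.trans hXE) hne hinc
    obtain ⟨hfin, hev⟩ := hX K hK
    have hfin' : (⋃₀ S ∩ K).Finite := hfin.subset (inter_subset_inter_left _ hSX)
    have hev' := even_ncard_inter_sUnion hSdj hfin' fun o ho ↦ heven o K (hS o ho).1 hK
    have heq : X ∩ K = insert x (⋃₀ S ∩ K) := by
      have h := Set.ext_iff.1 hKx
      simp only [mem_inter_iff, mem_sdiff, mem_singleton_iff] at h
      ext y
      have := h y
      have := @hSX y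
      simp only [mem_inter_iff, mem_insert_iff]
      grind
    rw [heq, ncard_insert_of_notMem (fun h ↦ hx.2 h.1) hfin', Nat.even_add_one] at hev
    exact hev hev'

/-! ### Symmetric differences of families -/

lemma IsSymmDiffOf.subset_iUnion {ι : Type*} {X : Set α} {o : ι → Set α}
    (h : IsSymmDiffOf X o) : X ⊆ ⋃ i, o i := by
  intro x hx
  obtain ⟨i, hi⟩ := nonempty_of_ncard_ne_zero ((h x).2.1 hx).pos.ne'
  exact mem_iUnion.2 ⟨i, hi⟩

lemma IsSymmDiffOf.even_ncard_inter {ι : Type*} [Finite ι] {X K : Set α} {o : ι → Set α}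
    (h : IsSymmDiffOf X o) (hK : ∀ i, (o i ∩ K).Finite ∧ Even (o i ∩ K).ncard) :
    (X ∩ K).Finite ∧ Even (X ∩ K).ncard := by
  classical
  have := Fintype.ofFinite ι
  have hF : (⋃ i, o i ∩ K).Finite := finite_iUnion fun i ↦ (hK i).1
  have hXF : X ∩ K ⊆ ⋃ i, o i ∩ K := by
    rw [← iUnion_inter]
    exact inter_subset_inter_left _ h.subset_iUnion
  refine ⟨hF.subset hXF, ?_⟩
  -- Count incidences between indices and points of `K` in two ways: each index contributes evenly,
  -- while the points with odd contribution form `X ∩ K`.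
  have hcount := Finset.sum_card_bipartiteAbove_eq_sum_card_bipartiteBelow
    (s := (Finset.univ : Finset ι)) (t := hF.toFinset) (fun i x ↦ x ∈ o i)
  have hleft : Even (∑ i, (hF.toFinset.bipartiteAbove (fun i x ↦ x ∈ o i) i).card) := by
    refine Finset.even_sum _ fun i _ ↦ ?_
    have heq : (hF.toFinset.bipartiteAbove (fun i x ↦ x ∈ o i) i : Set α) = o i ∩ K := ?_
    · rw [← ncard_coe_finset, heq]
      exact (hK i).2
    ext x
    simp only [Finset.bipartiteAbove, Finset.coe_filter, Finite.mem_toFinset, mem_iUnion,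
      mem_inter_iff, mem_ofPred_eq]
    grind
  rw [hcount, Finset.even_sum_iff_even_card_odd] at hleft
  convert hleft using 1
  rw [← ncard_coe_finset]
  congr 1
  ext x
  have hx : (Finset.univ.bipartiteBelow (fun i x ↦ x ∈ o i) x).card = {i | x ∈ o i}.ncard := by
    rw [← ncard_coe_finset]
    simp [Finset.bipartiteBelow]
  simp only [Finset.coe_filter, hx, ← (h x).2, Finite.mem_toFinset, mem_ofPred_eq]
  refine ⟨fun hxX ↦ ⟨hXF hxX, hxX.1⟩, fun ⟨hxF, hxX⟩ ↦ ⟨hxX, ?_⟩⟩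
  obtain ⟨i, hi⟩ := mem_iUnion.1 hxF
  exact hi.2

lemma isSymmDiffOf_symmDiff (o₁ o₂ : Set α) :
    IsSymmDiffOf (symmDiff o₁ o₂) (fun i : Bool ↦ cond i o₁ o₂) := by
  intro x
  refine ⟨toFinite _, ?_⟩
  by_cases h₁ : x ∈ o₁ <;> by_cases h₂ : x ∈ o₂
  · have : {i : Bool | x ∈ cond i o₁ o₂} = univ := by ext i; cases i <;> simp [h₁, h₂]
    rw [this]; simp [mem_symmDiff, h₁, h₂]
  · have : {i : Bool | x ∈ cond i o₁ o₂} = {true} := by ext i; cases i <;> simp [h₁, h₂]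
    rw [this]; simp [mem_symmDiff, h₁, h₂]
  · have : {i : Bool | x ∈ cond i o₁ o₂} = {false} := by ext i; cases i <;> simp [h₁, h₂]
    rw [this]; simp [mem_symmDiff, h₁, h₂]
  · have : {i : Bool | x ∈ cond i o₁ o₂} = ∅ := by ext i; cases i <;> simp [h₁, h₂]
    rw [this]; simp [mem_symmDiff, h₁, h₂]

lemma IsDisjointUnionOfCircuits.eq_empty_or_includesCircuit {X : Set α}
    (h : M.IsDisjointUnionOfCircuits X) : X = ∅ ∨ M.IncludesCircuit X := by
  obtain ⟨S, hS, -, rfl⟩ := h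
  obtain rfl | ⟨o, ho⟩ := S.eq_empty_or_nonempty
  · simp
  · exact Or.inr ⟨o, hS o ho, subset_sUnion_of_mem ho⟩

/-- Outside `s`, a point lies only in its own fundamental circuit. For `x ∈ s`, the members through
`x` are indexed by the elements of `o \ s` in the fundamental cocircuit of `x`; this cocircuit meets
`s` only in `x`, so `x` itself adds one exactly when `x ∈ o`. -/
lemma isSymmDiffOf_fundCircuit_iff {s o : Set α} (hM : M.Tame) (hs : M.IsBase s)
    (ho : M.IsCircuit o) :
    IsSymmDiffOf o (fun e : ↥(o \ s) ↦ M.fundCircuit (e : α) s) ↔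
      ∀ x ∈ s, Even (o ∩ M.fundCocircuit x s).ncard := by
  have hsub : ∀ x, {e : ↥(o \ s) | x ∈ M.fundCircuit (e : α) s}.ncard =
      ((o \ s) ∩ M.fundCocircuit x s).ncard := by
    intro x
    rw [← ncard_image_of_injective _ Subtype.val_injective]
    congr 1
    ext e
    simp [hs.mem_fundCocircuit_iff_mem_fundCircuit, and_comm]
  have hsubfin : ∀ x ∈ s, ((o \ s) ∩ M.fundCocircuit x s).Finite := fun x hx ↦
    (hM o _ ho (fundCocircuit_isCocircuit hx hs)).subset
      (inter_subset_inter_left _ sdiff_subset)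
  have hns : ∀ x ∉ s, {e : ↥(o \ s) | x ∈ M.fundCircuit (e : α) s} =
      {e : ↥(o \ s) | (e : α) = x} := by
    intro x hx
    ext e
    refine ⟨fun h ↦ ?_, ?_⟩
    · obtain h | h := M.fundCircuit_subset_insert _ _ h
      · exact h.symm
      · exact (hx h).elim
    · rintro rfl
      exact mem_fundCircuit _ _ _
  have hparity : ∀ x ∈ s, ((x ∈ o ↔ Odd ((o \ s) ∩ M.fundCocircuit x s).ncard) ↔
      Even (o ∩ M.fundCocircuit x s).ncard) := by
    intro x hx
    have hinter := M.fundCocircuit_inter_eq hx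
    have hmem : ∀ y, y ∈ M.fundCocircuit x s → y ∈ s → y = x := fun y hy hys ↦
      hinter.subset ⟨hy, hys⟩
    have hxK := M.mem_fundCocircuit x s
    by_cases hxo : x ∈ o
    · have heq : o ∩ M.fundCocircuit x s = insert x ((o \ s) ∩ M.fundCocircuit x s) := by
        ext y
        have := hmem y
        simp only [mem_inter_iff, mem_insert_iff, mem_sdiff]
        grind
      rw [heq, ncard_insert_of_notMem (fun h ↦ h.1.2 hx) (hsubfin x hx), Nat.even_add_one,
        Nat.not_even_iff_odd]
      simp [hxo]
    · have heq : o ∩ M.fundCocircuit x s = (o \ s) ∩ M.fundCocircuit x s := by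
        ext y
        have := hmem y
        simp only [mem_inter_iff, mem_sdiff]
        grind
      rw [heq]
      simp [hxo]
  refine ⟨fun h x hx ↦ (hparity x hx).1 ?_, fun h x ↦ ?_⟩
  · rw [← hsub]
    exact (h x).2
  by_cases hx : x ∈ s
  · rw [hsub, hparity x hx]
    refine ⟨Finite.of_finite_image ((hsubfin x hx).subset ?_) Subtype.val_injective.injOn, h x hx⟩
    rintro _ ⟨e, he, rfl⟩
    exact ⟨e.2, hs.mem_fundCocircuit_iff_mem_fundCircuit.2 he⟩
  · rw [hns x hx]
    have hss : {e : ↥(o \ s) | (e : α) = x}.Subsingleton := fun a ha b hb ↦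
      Subtype.ext (Eq.trans ha (Eq.symm hb))
    refine ⟨hss.finite, ?_⟩
    by_cases hxo : x ∈ o
    · have : {e : ↥(o \ s) | (e : α) = x} = {⟨x, hxo, hx⟩} := by
        ext e
        simp [Subtype.ext_iff]
      rw [this]
      simp [hxo]
    · have : {e : ↥(o \ s) | (e : α) = x} = ∅ := by
        ext e
        simp only [mem_ofPred_eq, mem_empty_iff_false, iff_false]
        rintro rfl
        exact hxo e.2.1
      rw [this]
      simp [hxo]

/-! ### Thin sums over the two-element field -/

lemma zmod_two_eq_one {a : ZMod 2} (h : a ≠ 0) : a = 1 := by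
  revert a
  decide

/-- Over `ZMod 2`, a sum all of whose terms are `0` or `1` vanishes iff evenly many terms do not. -/
lemma finsum_zmod_two_eq_zero_iff {ι : Type*} {g : ι → ZMod 2} (hg : {e | g e ≠ 0}.Finite) :
    ∑ᶠ e, g e = 0 ↔ Even {e | g e ≠ 0}.ncard := by
  rw [finsum_eq_sum_of_support_subset (s := hg.toFinset) g (by simp [Function.support]),
    Finset.sum_congr rfl (g := fun _ ↦ (1 : ZMod 2))
      fun x hx ↦ zmod_two_eq_one (hg.mem_toFinset.1 hx),
    Finset.sum_const, nsmul_one, ZMod.natCast_eq_zero_iff_even, ncard_eq_toFinset_card _ hg]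

lemma IsThinDependence.add {ι : Type*} {A : Type*} {k : Type*} [Field k] {f : ι → A → k}
    {c d : ι → k} (hc : IsThinDependence f c) (hd : IsThinDependence f d) :
    IsThinDependence f (c + d) := by
  intro a
  have hadd : ∀ e, (c + d) e * f e a = c e * f e a + d e * f e a := fun e ↦ add_mul _ _ _
  refine ⟨((hc a).1.union (hd a).1).subset fun e he ↦ ?_, ?_⟩
  · by_contra hcon
    simp only [mem_union, mem_ofPred_eq, not_or, not_not] at hcon
    exact he (by rw [hadd, hcon.1, hcon.2, add_zero])
  · rw [finsum_congr hadd, finsum_add_distrib (hc a).1 (hd a).1, (hc a).2, (hd a).2, add_zero]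

/-- In a binary thin sums matroid the indicator function of a circuit is a thin dependence. -/
lemma IsCircuit.isThinDependence_indicator {A : Type*} {f : M.E → A → ZMod 2}
    (hf : ∀ I : Set M.E, M.Indep (Subtype.val '' I) ↔ ThinlyIndependent f I) {o : Set α}
    (ho : M.IsCircuit o) :
    IsThinDependence f ((Subtype.val ⁻¹' o).indicator (fun _ ↦ (1 : ZMod 2))) := by
  have himg : Subtype.val '' ((↑) ⁻¹' o : Set M.E) = o := by
    rw [Subtype.image_preimage_coe, inter_eq_right]
    exact ho.subset_ground
  have hni : ¬ ThinlyIndependent f ((↑) ⁻¹' o : Set M.E) := by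
    rw [← hf, himg]
    exact ho.not_indep
  simp only [ThinlyIndependent, not_forall] at hni
  obtain ⟨c, hc, hco, hc0⟩ := hni
  convert hc
  ext e
  by_cases heo : e ∈ ((↑) ⁻¹' o : Set M.E)
  · rw [indicator_of_mem heo]
    -- Were `c e` zero, `c` would be supported on the independent set `o \ {e}` and hence vanish.
    refine (zmod_two_eq_one fun he ↦ hc0 ?_).symm
    have hind : ThinlyIndependent f ((↑) ⁻¹' (o \ {(e : α)}) : Set M.E) := by
      rw [← hf]
      refine (ho.sdiff_singleton_indep heo).subset ?_
      exact image_preimage_subset _ _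
    refine hind c hc fun e' he' ↦ ?_
    by_cases hee : e' = e
    · rw [hee, he]
    · exact hco e' fun h ↦ he' ⟨h, fun h' ↦ hee (Subtype.ext h')⟩
  · rw [indicator_of_notMem heo, hco e heo]

/-- The two circuit indicators add up to a thin dependence supported exactly on the symmetric
difference, since `1 + 1 = 0`. -/
lemma IsThinSums.symmDiff_eq_empty_or_includesCircuit (hM : M.IsThinSums (ZMod 2)) {o₁ o₂ : Set α}
    (ho₁ : M.IsCircuit o₁) (ho₂ : M.IsCircuit o₂) :
    symmDiff o₁ o₂ = ∅ ∨ M.IncludesCircuit (symmDiff o₁ o₂) := by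
  obtain ⟨A, f, hf⟩ := hM
  by_contra! hcon
  have hE : symmDiff o₁ o₂ ⊆ M.E :=
    symmDiff_subset_union.trans (union_subset ho₁.subset_ground ho₂.subset_ground)
  have hI : M.Indep (symmDiff o₁ o₂) := by
    by_contra h
    obtain ⟨o, hoX, ho⟩ := Dep.exists_isCircuit_subset ⟨h, hE⟩
    exact hcon.2 ⟨o, ho, hoX⟩
  have hthin : ThinlyIndependent f ((↑) ⁻¹' (symmDiff o₁ o₂) : Set M.E) := by
    rw [← hf]
    exact hI.subset (image_preimage_subset _ _)
  have hzero := hthin _ ((ho₁.isThinDependence_indicator hf).add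
    (ho₂.isThinDependence_indicator hf)) fun e he ↦ by
      by_cases h₁ : (e : α) ∈ o₁ <;> by_cases h₂ : (e : α) ∈ o₂ <;>
        simp_all [mem_symmDiff, indicator]
      decide
  obtain ⟨x, hx⟩ := hcon.1
  have hx0 := congrFun hzero ⟨x, hE hx⟩
  obtain ⟨h₁, h₂⟩ | ⟨h₁, h₂⟩ := hx <;> simp [indicator, h₁, h₂] at hx0

/-- Each element is represented by its incidence vector against all cocircuits. A cocircuit meeting
the support of `c` once gives a nonzero coordinate sum; conversely, evenness turns circuit
indicators into dependences. -/
lemma isThinSums_of_even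
    (heven : ∀ o K, M.IsCircuit o → M.IsCocircuit K → (o ∩ K).Finite ∧ Even (o ∩ K).ncard) :
    M.IsThinSums (ZMod 2) := by
  classical
  let f : M.E → {K : Set α // M.IsCocircuit K} → ZMod 2 := fun e K ↦ if (e : α) ∈ K.1 then 1 else 0
  refine ⟨{K : Set α // M.IsCocircuit K}, f, fun I ↦ ⟨fun hI c hc hcI ↦ ?_, fun hI ↦ ?_⟩⟩
  · by_contra hne
    obtain ⟨e, he⟩ : ∃ e, c e ≠ 0 := by
      by_contra! h
      exact hne (funext h)
    have hind : M.Indep (Subtype.val '' {e | c e ≠ 0}) := by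
      refine hI.subset (image_mono fun e he ↦ ?_)
      by_contra heI
      exact he (hcI e heI)
    obtain ⟨K, hK, hKI⟩ := hind.exists_isCocircuit_inter_eq_mem (mem_image_of_mem _ he)
    have heK : (e : α) ∈ K := (hKI.symm.subset rfl).1
    obtain ⟨hfin, hsum⟩ := hc ⟨K, hK⟩
    rw [finsum_zmod_two_eq_zero_iff hfin] at hsum
    have hset : {e' | c e' * f e' ⟨K, hK⟩ ≠ 0} = {e} := by
      ext e'
      simp only [f, mem_ofPred_eq, mem_singleton_iff]
      constructor
      · intro h
        have hcK : c e' ≠ 0 ∧ (e' : α) ∈ K := by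
          by_cases hK' : (e' : α) ∈ K <;> simp_all
        exact Subtype.ext (hKI.subset ⟨hcK.2, mem_image_of_mem _ hcK.1⟩)
      · rintro rfl
        simpa [heK] using he
    rw [hset] at hsum
    simp at hsum
  · by_contra hnI
    obtain ⟨o, hoI, ho⟩ := Dep.exists_isCircuit_subset
      (M := M) ⟨hnI, by rintro _ ⟨e, -, rfl⟩; exact e.2⟩
    have hset : ∀ K : {K : Set α // M.IsCocircuit K}, Subtype.val ''
        {e : M.E | ((↑) ⁻¹' o : Set M.E).indicator (fun _ ↦ (1 : ZMod 2)) e * f e K ≠ 0} =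
        o ∩ K.1 := by
      intro K
      ext x
      simp only [f, mem_image, mem_ofPred_eq, mem_inter_iff, indicator, mem_preimage]
      constructor
      · rintro ⟨e, he, rfl⟩
        by_cases h₁ : (e : α) ∈ o <;> by_cases h₂ : (e : α) ∈ K.1 <;> simp_all
      · rintro ⟨h₁, h₂⟩
        exact ⟨⟨x, ho.subset_ground h₁⟩, by simp [h₁, h₂], rfl⟩
    have hdep : IsThinDependence f
        (((↑) ⁻¹' o : Set M.E).indicator (fun _ ↦ (1 : ZMod 2))) := by
      intro K
      obtain ⟨hfin, hev⟩ := heven o K.1 ho K.2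
      rw [← hset K] at hfin hev
      have hfin' := Finite.of_finite_image hfin Subtype.val_injective.injOn
      rw [ncard_image_of_injective _ Subtype.val_injective] at hev
      exact ⟨hfin', (finsum_zmod_two_eq_zero_iff hfin').2 hev⟩
    have hzero := hI _ hdep fun e he ↦ indicator_of_notMem (fun heo ↦ he ?_) _
    · obtain ⟨x, hx⟩ := ho.nonempty
      have := congrFun hzero ⟨x, ho.subset_ground hx⟩
      simp [indicator, hx] at this
    · obtain ⟨e', he', heq⟩ := hoI heo
      exact Subtype.ext heq ▸ he'

end Matroid

theorem theorem3p1 {α : Type*} (M : Matroid α) (hM : M.Tame) :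
    List.TFAE [
      -- (1) `M` is a binary thin sums matroid
      M.IsThinSums (ZMod 2),
      -- (2) circuits and cocircuits have (finite) intersections of even size
      ∀ o b : Set α, M.IsCircuit o → M.IsCocircuit b →
        (o ∩ b).Finite ∧ Even (o ∩ b).ncard,
      -- (3) no circuit and cocircuit have an intersection of size three
      ∀ o b : Set α, M.IsCircuit o → M.IsCocircuit b → (o ∩ b).encard ≠ 3,
      -- (4) no minor is isomorphic to `U_{2,4}`
      ¬ ∃ N : Matroid α, N ≤m M ∧ N.Isomorphic (Matroid.uniformMatroid 2 4),
      -- (5)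
      ∀ o₁ o₂ : Set α, M.IsCircuit o₁ → M.IsCircuit o₂ →
        symmDiff o₁ o₂ = ∅ ∨ M.IncludesCircuit (symmDiff o₁ o₂),
      -- (6)
      ∀ o₁ o₂ : Set α, M.IsCircuit o₁ → M.IsCircuit o₂ →
        M.IsDisjointUnionOfCircuits (symmDiff o₁ o₂),
      -- (7)
      ∀ (ι : Type) [Finite ι] (o : ι → Set α) (X : Set α), (∀ i, M.IsCircuit (o i)) →
        Matroid.IsSymmDiffOf X o → X = ∅ ∨ M.IncludesCircuit X,
      -- (8)
      ∀ (ι : Type) [Finite ι] (o : ι → Set α) (X : Set α), (∀ i, M.IsCircuit (o i)) →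
        Matroid.IsSymmDiffOf X o → M.IsDisjointUnionOfCircuits X,
      -- (9) circuits are symmetric differences of fundamental circuits, for every base
      ∀ s o : Set α, M.IsBase s → M.IsCircuit o →
        Matroid.IsSymmDiffOf o (fun e : ↥(o \ s) => M.fundCircuit (e : α) s)] := by

  have quad_two : (∀ C q, ¬ M.IsQuad C q) → ∀ o b : Set α, M.IsCircuit o → M.IsCocircuit b →
      (o ∩ b).Finite ∧ Even (o ∩ b).ncard := fun h o b ho hb ↦
    ⟨hM o b ho hb, Matroid.even_ncard_inter_of_forall_not_isQuad hM h ho b hb⟩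
  tfae_have 2 → 1 := Matroid.isThinSums_of_even
  tfae_have 1 → 5 := fun h _ _ ho₁ ho₂ ↦ h.symmDiff_eq_empty_or_includesCircuit ho₁ ho₂
  tfae_have 5 → 2 := by
    refine fun h ↦ quad_two fun C q hq ↦ ?_
    obtain ⟨o₁, o₂, ho₁, ho₂, hne, hI⟩ := hq.exists_isCircuit_symmDiff
    obtain h' | ⟨o, ho, hos⟩ := h o₁ o₂ ho₁ ho₂
    · exact hne.ne_empty h'
    · exact ho.not_indep (hI.subset hos)
  tfae_have 2 → 3 := by
    intro h o b ho hb heq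
    have h3 : (o ∩ b).ncard = 3 := by simp [Set.ncard, heq]
    have := (h o b ho hb).2
    rw [h3] at this
    exact absurd this (by decide)
  tfae_have 3 → 4 := by
    rintro h ⟨N, hN, hiso⟩
    obtain ⟨C, q, hq⟩ := Matroid.exists_isQuad_of_isMinor hN hiso
    obtain ⟨o, b, ho, hb, h3⟩ := hq.exists_isCircuit_isCocircuit
    exact h o b ho hb h3
  tfae_have 4 → 2 := fun h ↦ quad_two fun C q hq ↦ h hq.exists_isMinor
  tfae_have 2 → 8 := fun h ι _ o X ho hX ↦
    Matroid.isDisjointUnionOfCircuits_of_even (fun o K ho hK ↦ (h o K ho hK).2)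
      (hX.subset_iUnion.trans (Set.iUnion_subset fun i ↦ (ho i).subset_ground))
      fun K hK ↦ hX.even_ncard_inter fun i ↦ h (o i) K (ho i) hK
  tfae_have 8 → 7 := fun h ι _ o X ho hX ↦ (h ι o X ho hX).eq_empty_or_includesCircuit
  tfae_have 7 → 5 := fun h o₁ o₂ ho₁ ho₂ ↦
    h Bool _ _ (fun i ↦ by cases i <;> assumption) (Matroid.isSymmDiffOf_symmDiff o₁ o₂)
  tfae_have 8 → 6 := fun h o₁ o₂ ho₁ ho₂ ↦
    h Bool _ _ (fun i ↦ by cases i <;> assumption) (Matroid.isSymmDiffOf_symmDiff o₁ o₂)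
  tfae_have 6 → 5 := fun h o₁ o₂ ho₁ ho₂ ↦ (h o₁ o₂ ho₁ ho₂).eq_empty_or_includesCircuit
  tfae_have 2 → 9 := fun h s o hs ho ↦ (Matroid.isSymmDiffOf_fundCircuit_iff hM hs ho).2
    fun x hx ↦ (h o _ ho (Matroid.fundCocircuit_isCocircuit hx hs)).2
  tfae_have 9 → 2 := by
    intro h o b ho hb
    -- Any cocircuit is fundamental for some base, so testing all bases tests all cocircuits.
    obtain ⟨x, hx⟩ := hb.nonempty
    obtain ⟨s, hs, hxs, -, -, rfl⟩ :=
      hb.exists_isBase_fundCocircuit_eq M.empty_indep (Set.empty_disjoint b) hx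
    exact ⟨hM o _ ho hb, (Matroid.isSymmDiffOf_fundCircuit_iff hM hs ho).1 (h s o hs ho) x hxs⟩
  tfae_finish
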